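/- Let $n\ge 2$. A set $L\subset\mathbb R^n$ is a star set if $0\in L$ and every line through $0$ meets $L$ in a (possibly degenerate, closed bounded) line segment. Its radial function is $\rho_L(t)=\sup\{c\ge 0: ct\in L\}$ for $t$ in the Euclidean unit sphere $S^{n-1}$. A star body is a star set with continuous radial function; let $\mathcal S_0^n$ be the set of star bodies. For star sets $K,L$ let $K\tilde+L$ be the star set with radial function $\rho_K+\rho_L$. The radial metric on $\mathcal S_0^n$ is $$\delta(K,L)=\inf\{\lambda\ge 0: K\subset L\tilde+\lambda B_n,\ L\subset K\tilde+\lambda B_n\},$$ where $B_n$ is the closed Euclidean unit ball. A function $V:\mathcal S_0^n\to\mathbb R$ is a valuation if $V(K\cup L)+V(K\cap L)=V(K)+V(L)$ for all $K,L\in\mathcal S_0^n$; it is radial continuous if it is continuous with respect to $\delta$; it is rotationally invariant if $V(\varphi(K))=V(K)$ for all $\varphi\in SO(n)$ and $K\in\mathcal S_0^n$. Let $m$ be the Lebesgue (surface) measure on $S^{n-1}$ normalized so that $m(S^{n-1})=1$. (1) If $V:\mathcal S_0^n\to\mathbb R$ is a rotationally invariant radial continuous valuation, then there is a continuous function $\theta:[0,\infty)\to\mathbb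 R$ such that, for every $K\in\mathcal S_0^n$, $$V(K)=\int_{S^{n-1}}\theta(\rho_K(t))\,dm(t).$$ (2) Conversely, if $\theta:[0,\infty)\to\mathbb R$ is continuous, then $V(K)=\int_{S^{n-1}}\theta(\rho_K(t))\,dm(t)$ defines a rotationally invariant radial continuous valuation $V:\mathcal S_0^n\to\mathbb R$. -/

import Mathlib

open MeasureTheory

/-- The Euclidean space of dimension `n`. -/
abbrev Euc (n : ℕ) : Type := EuclideanSpace ℝ (Fin n)

/-- The Euclidean unit sphere. -/
abbrev USphere (n : ℕ) : Type := Metric.sphere (0 : Euc n) 1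

/-- A star set contains the origin, and every line through the origin meets it in a
(possibly degenerate) line segment. -/
def IsStarSet {n : ℕ} (L : Set (Euc n)) : Prop :=
  (0 : Euc n) ∈ L ∧
    ∀ v : Euc n, v ≠ 0 → ∃ a b : Euc n,
      L ∩ (Submodule.span ℝ {v} : Set (Euc n)) = segment ℝ a b

/-- The radial function of a set, on the unit sphere. -/
noncomputable def radialFun {n : ℕ} (L : Set (Euc n)) (t : USphere n) : ℝ :=
  sSup {c : ℝ | 0 ≤ c ∧ c • (t : Euc n) ∈ L}

/-- The star set with prescribed (nonnegative) radial function `f`. -/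
def starSetOf {n : ℕ} (f : USphere n → ℝ) : Set (Euc n) :=
  {x | x = 0 ∨ ∃ (t : USphere n) (c : ℝ), 0 ≤ c ∧ c ≤ f t ∧ x = c • (t : Euc n)}

/-- A star body is a star set with continuous radial function. -/
structure StarBody (n : ℕ) where
  carrier : Set (Euc n)
  isStarSet : IsStarSet carrier
  continuous_radialFun : Continuous (radialFun carrier)

theorem IsStarSet.smul_mem_iff {n : ℕ} {L : Set (Euc n)} (hL : IsStarSet L) (t : USphere n)
    {c : ℝ} (hc : 0 ≤ c) : c • (t : Euc n) ∈ L ↔ c ≤ radialFun L t := by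
  have ht : ‖(t : Euc n)‖ = 1 := by simp
  have ht0 : (t : Euc n) ≠ 0 := by
    intro h; rw [h] at ht; simp at ht
  obtain ⟨a, b, hab⟩ := hL.2 t ht0
  set S : Set ℝ := {c : ℝ | 0 ≤ c ∧ c • (t : Euc n) ∈ L} with hS
  have hmem : ∀ d : ℝ, d • (t : Euc n) ∈ L ↔ d • (t : Euc n) ∈ segment ℝ a b := by
    intro d
    rw [← hab]
    exact ⟨fun h => ⟨h, Submodule.smul_mem _ _ (Submodule.mem_span_singleton_self _)⟩,
      fun h => h.1⟩
  have hcont : Continuous (fun d : ℝ => d • (t : Euc n)) := by fun_prop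
  have hcomp : IsCompact (segment ℝ a b) := by
    rw [segment_eq_image_lineMap]
    exact isCompact_Icc.image AffineMap.lineMap_continuous
  have hclosed : IsClosed S := by
    have : S = Set.Ici 0 ∩ (fun d : ℝ => d • (t : Euc n)) ⁻¹' segment ℝ a b := by
      ext d; simp [hS, hmem d]
    rw [this]
    exact isClosed_Ici.inter (hcomp.isClosed.preimage hcont)
  have hbdd : BddAbove S := by
    obtain ⟨R, hR⟩ := hcomp.isBounded.exists_norm_le
    refine ⟨R, fun d hd => ?_⟩
    have := hR _ ((hmem d).1 hd.2)
    rw [norm_smul, ht, mul_one] at this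
    exact (le_abs_self d).trans this
  have hne : S.Nonempty := ⟨0, le_rfl, by simpa using hL.1⟩
  have hsup : sSup S ∈ S := hclosed.csSup_mem hne hbdd
  constructor
  · intro h
    exact le_csSup hbdd ⟨hc, h⟩
  · intro h
    change c ≤ sSup S at h
    have h0 : (0 : Euc n) ∈ segment ℝ a b := by
      have := (hmem 0).1 (by simpa using hL.1)
      simpa using this
    have h1 := (hmem _).1 hsup.2
    rw [hmem]
    rcases hc.eq_or_lt with rfl | hpos
    · simpa using h0
    have hSpos : 0 < sSup S := hpos.trans_le h
    have := (convex_segment a b).smul_mem_of_zero_mem h0 h1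
      (t := c / sSup S) ⟨by positivity, (div_le_one hSpos).2 h⟩
    rwa [smul_smul, div_mul_cancel₀ _ hSpos.ne'] at this

theorem radialFun_nonneg {n : ℕ} (L : Set (Euc n)) (t : USphere n) : 0 ≤ radialFun L t :=
  Real.sSup_nonneg fun _ h => h.1

theorem smul_mem_starSetOf_iff {n : ℕ} {f : USphere n → ℝ} (hf : ∀ t, 0 ≤ f t)
    (t : USphere n) {c : ℝ} (hc : 0 ≤ c) : c • (t : Euc n) ∈ starSetOf f ↔ c ≤ f t := by
  have hn : ∀ t : USphere n, ‖(t : Euc n)‖ = 1 := fun t => by simp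
  constructor
  · rintro (h | ⟨s, d, hd, hds, h⟩)
    · have := congrArg norm h
      rw [norm_smul, hn, Real.norm_of_nonneg hc, norm_zero, mul_one] at this
      exact this ▸ hf t
    · have hcd := congrArg norm h
      rw [norm_smul, norm_smul, hn, hn, Real.norm_of_nonneg hc, Real.norm_of_nonneg hd, mul_one,
        mul_one] at hcd
      subst hcd
      rcases hc.eq_or_lt with rfl | hpos
      · exact hf t
      · have : t = s := Subtype.ext (smul_right_injective _ hpos.ne' h)
        rwa [this]
  · exact fun h => Or.inr ⟨t, c, hc, h, rfl⟩

theorem radialFun_starSetOf {n : ℕ} {f : USphere n → ℝ} (hf : ∀ t, 0 ≤ f t) :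
    radialFun (starSetOf f) = f := by
  funext t
  have : {c : ℝ | 0 ≤ c ∧ c • (t : Euc n) ∈ starSetOf f} = Set.Icc 0 (f t) := by
    ext c
    exact and_congr_right fun hc => smul_mem_starSetOf_iff hf t hc
  rw [radialFun, this, csSup_Icc (hf t)]

theorem exists_polar {n : ℕ} {x : Euc n} (hx : x ≠ 0) :
    ∃ (t : USphere n) (c : ℝ), 0 < c ∧ x = c • (t : Euc n) := by
  have hx' : ‖x‖ ≠ 0 := norm_ne_zero_iff.2 hx
  refine ⟨⟨‖x‖⁻¹ • x, ?_⟩, ‖x‖, norm_pos_iff.2 hx, ?_⟩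
  · simp [norm_smul, hx']
  · simp [smul_smul, hx']

theorem isStarSet_starSetOf {n : ℕ} {f : USphere n → ℝ} (hf : ∀ t, 0 ≤ f t) :
    IsStarSet (starSetOf f) := by
  refine ⟨Or.inl rfl, fun v hv => ?_⟩
  obtain ⟨t, r, hr, rfl⟩ := exists_polar hv
  have hspan : ∀ x : Euc n, x ∈ (Submodule.span ℝ {r • (t : Euc n)} : Set (Euc n)) ↔
      ∃ d : ℝ, x = d • (t : Euc n) := by
    intro x
    rw [SetLike.mem_coe, Submodule.mem_span_singleton]
    constructor
    · rintro ⟨a, rfl⟩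
      exact ⟨a * r, by rw [smul_smul]⟩
    · rintro ⟨d, rfl⟩
      exact ⟨d / r, by rw [smul_smul, div_mul_cancel₀ _ hr.ne']⟩
  have hseg : segment ℝ ((-f (-t)) • (t : Euc n)) ((f t) • (t : Euc n)) =
      (fun d : ℝ => d • (t : Euc n)) '' Set.Icc (-f (-t)) (f t) := by
    have h := image_segment ℝ (LinearMap.toSpanSingleton ℝ (Euc n) (t : Euc n)).toAffineMap
      (-f (-t)) (f t)
    rw [segment_eq_Icc (by linarith [hf t, hf (-t)])] at h
    simpa using h.symm
  refine ⟨_, _, Eq.trans ?_ hseg.symm⟩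
  ext x
  rw [Set.mem_inter_iff, hspan]
  constructor
  · rintro ⟨hx, d, rfl⟩
    refine ⟨d, ?_, rfl⟩
    rcases le_total 0 d with hd | hd
    · exact ⟨by linarith [hf (-t)], (smul_mem_starSetOf_iff hf t hd).1 hx⟩
    · have := (smul_mem_starSetOf_iff hf (-t) (neg_nonneg.2 hd)).1 (by simpa using hx)
      exact ⟨by linarith, hd.trans (hf t)⟩
  · rintro ⟨d, ⟨h1, h2⟩, rfl⟩
    refine ⟨?_, d, rfl⟩
    rcases le_total 0 d with hd | hd
    · exact (smul_mem_starSetOf_iff hf t hd).2 h2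
    · have := (smul_mem_starSetOf_iff hf (-t) (neg_nonneg.2 hd)).2 (by linarith)
      simpa using this

/-- A set containing the origin is determined by its intersections with rays. -/
theorem eq_starSetOf {n : ℕ} {L : Set (Euc n)} {f : USphere n → ℝ} (hf : ∀ t, 0 ≤ f t)
    (h0 : (0 : Euc n) ∈ L)
    (h : ∀ (t : USphere n) (c : ℝ), 0 ≤ c → (c • (t : Euc n) ∈ L ↔ c ≤ f t)) :
    L = starSetOf f := by
  ext x
  by_cases hx : x = 0
  · subst hx
    exact ⟨fun _ => Or.inl rfl, fun _ => h0⟩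
  · obtain ⟨t, c, hc, rfl⟩ := exists_polar hx
    rw [h t c hc.le, smul_mem_starSetOf_iff hf t hc.le]

theorem StarBody.union_eq {n : ℕ} (K L : StarBody n) : K.carrier ∪ L.carrier =
    starSetOf (fun t => max (radialFun K.carrier t) (radialFun L.carrier t)) :=
  eq_starSetOf (fun t => le_max_of_le_left (radialFun_nonneg _ t)) (Or.inl K.isStarSet.1)
    fun t c hc => by
      rw [Set.mem_union, K.isStarSet.smul_mem_iff t hc, L.isStarSet.smul_mem_iff t hc, le_max_iff]

theorem StarBody.inter_eq {n : ℕ} (K L : StarBody n) : K.carrier ∩ L.carrier =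
    starSetOf (fun t => min (radialFun K.carrier t) (radialFun L.carrier t)) :=
  eq_starSetOf (fun t => le_min (radialFun_nonneg _ t) (radialFun_nonneg _ t))
    ⟨K.isStarSet.1, L.isStarSet.1⟩
    fun t c hc => by
      rw [Set.mem_inter_iff, K.isStarSet.smul_mem_iff t hc, L.isStarSet.smul_mem_iff t hc,
        le_min_iff]

/-- The union of two star bodies. -/
instance {n : ℕ} : Union (StarBody n) where
  union K L :=
    { carrier := K.carrier ∪ L.carrier
      isStarSet := by
        rw [K.union_eq L]
        exact isStarSet_starSetOf fun t => le_max_of_le_left (radialFun_nonneg _ t)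
      continuous_radialFun := by
        rw [K.union_eq L, radialFun_starSetOf fun t => le_max_of_le_left (radialFun_nonneg _ t)]
        exact K.continuous_radialFun.max L.continuous_radialFun }

/-- The intersection of two star bodies. -/
instance {n : ℕ} : Inter (StarBody n) where
  inter K L :=
    { carrier := K.carrier ∩ L.carrier
      isStarSet := by
        rw [K.inter_eq L]
        exact isStarSet_starSetOf fun t => le_min (radialFun_nonneg _ t) (radialFun_nonneg _ t)
      continuous_radialFun := by
        rw [K.inter_eq L, radialFun_starSetOf
          fun t => le_min (radialFun_nonneg _ t) (radialFun_nonneg _ t)]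
        exact K.continuous_radialFun.min L.continuous_radialFun }

theorem StarBody.image_eq {n : ℕ} (φ : Euc n ≃ₗᵢ[ℝ] Euc n) (K : StarBody n) :
    φ '' K.carrier = starSetOf (fun t : USphere n =>
      radialFun K.carrier ⟨φ.symm (t : Euc n), by simp⟩) :=
  eq_starSetOf (fun t => radialFun_nonneg _ _) ⟨0, K.isStarSet.1, map_zero φ⟩
    fun t c hc => by
      rw [← K.isStarSet.smul_mem_iff _ hc]
      constructor
      · rintro ⟨x, hx, h⟩
        have : x = c • φ.symm (t : Euc n) := by rw [← map_smul, ← h, φ.symm_apply_apply]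
        simpa [this] using hx
      · intro h
        exact ⟨_, h, by simp⟩

/-- The image of a star body under a linear isometry. -/
def StarBody.map {n : ℕ} (φ : Euc n ≃ₗᵢ[ℝ] Euc n) (K : StarBody n) : StarBody n where
  carrier := φ '' K.carrier
  isStarSet := by
    rw [K.image_eq φ]
    exact isStarSet_starSetOf fun t => radialFun_nonneg _ _
  continuous_radialFun := by
    rw [K.image_eq φ, radialFun_starSetOf fun t => radialFun_nonneg _ _]
    exact K.continuous_radialFun.comp
      (Continuous.subtype_mk (φ.symm.continuous.comp continuous_subtype_val) _)

/-- The radial sum: the star set whose radial function is the sum of the radial functions. -/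
noncomputable def radialSum {n : ℕ} (K L : Set (Euc n)) : Set (Euc n) :=
  starSetOf fun t => radialFun K t + radialFun L t

/-- The radial metric. -/
noncomputable def radialDist {n : ℕ} (K L : StarBody n) : ℝ :=
  sInf {r : ℝ | 0 ≤ r ∧
    K.carrier ⊆ radialSum L.carrier (Metric.closedBall 0 r) ∧
    L.carrier ⊆ radialSum K.carrier (Metric.closedBall 0 r)}

/-- Continuity with respect to the radial metric. -/
def IsRadialContinuous {n : ℕ} (V : StarBody n → ℝ) : Prop :=
  ∀ K : StarBody n, ∀ ε > 0, ∃ δ > 0, ∀ L : StarBody n, radialDist K L < δ → |V L - V K| < ε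

/-- Valuations on star bodies. -/
def IsValuation {n : ℕ} (V : StarBody n → ℝ) : Prop :=
  ∀ K L : StarBody n, V (K ∪ L) + V (K ∩ L) = V K + V L

/-- Invariance under all rotations (linear isometries of determinant one). -/
def IsRotationInvariant {n : ℕ} (V : StarBody n → ℝ) : Prop :=
  ∀ φ : Euc n ≃ₗᵢ[ℝ] Euc n, LinearMap.det (φ.toLinearEquiv : Euc n →ₗ[ℝ] Euc n) = 1 →
    ∀ K : StarBody n, V (K.map φ) = V K

/-- The rotation invariant surface (Lebesgue) measure on the unit sphere, normalized to have
total mass one. -/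
noncomputable def sphereMeasure (n : ℕ) : Measure (USphere n) :=
  ((volume : Measure (Euc n)).toSphere Set.univ)⁻¹ • (volume : Measure (Euc n)).toSphere

/-! ### Valuations on the lattice of continuous functions -/

section Valuation

variable {X : Type*} [TopologicalSpace X]

/-! Via radial functions, star bodies are the nonnegative continuous functions on the sphere: union
and intersection become max and min, the radial metric becomes the sup distance. So `V` becomes, up
to a constant, a continuous valuation `F` on C(X) with F(0) = 0, and necessarily θ(c) is the value
of `V` on the ball of radius c.

Such an `F` is additive on disjointly supported nonnegative functions and bounded on order intervals
[0, M]. Hence it cannot be large on many disjoint functions at once, and each small ball has a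
nearby radius whose bounding shell is negligible for `F` (`exists_shell_valuation_abs_le`). Cutting
along such shells gives disjoint bumps g_j near points y_j with F(p) ≈ ∑ F(p(y_j) g_j), up to ε
(`exists_cells`). The bumps depend on the scale and on M, but not on p.

Put T_j(x) = F(f(x) g_j). Applied to all rotates of f, this gives F(f) ≈ ∑ T_j(φ⁻¹ y_j) for every
rotation φ; averaging over φ gives F(f) ≈ ∑ ∫ T_j dm. Applied to the constant f(x), it gives F(f(x))
≈ ∑ T_j(x), with the same integral. Thus F(f) = ∫ F(f(x)) dm (`valuation_eq_integral`). No
representing measure or control of the individual F(c g_j) is needed.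

The converse holds because θ(max) + θ(min) is pointwise the sum of the two values, composition with
θ is continuous in sup norm, and the surface measure is rotation invariant. -/

theorem ContinuousMap.sum_apply_eq_zero_or_of_pairwise_mul_eq_zero {ι : Type*} (s : Finset ι)
    (u : ι → C(X, ℝ)) (hd : (s : Set ι).Pairwise fun i j => u i * u j = 0) (x : X) :
    (∀ i ∈ s, u i x = 0) ∨ ∃ i ∈ s, (∑ j ∈ s, u j) x = u i x := by
  by_cases h : ∀ i ∈ s, u i x = 0
  · exact Or.inl h
  · push Not at h
    obtain ⟨i, hi, hix⟩ := h
    refine Or.inr ⟨i, hi, ?_⟩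
    rw [ContinuousMap.sum_apply]
    refine Finset.sum_eq_single_of_mem i hi fun j hj hji => ?_
    have := DFunLike.congr_fun (hd hi hj hji.symm) x
    simpa [hix] using this

/-- For nonnegative functions with product zero, the max is the sum and the min is 0, so the
valuation identity reads as additivity. -/
theorem valuation_sum_of_pairwise_mul_eq_zero {F : C(X, ℝ) → ℝ} (h0 : F 0 = 0)
    (hval : ∀ f g, F (f ⊔ g) + F (f ⊓ g) = F f + F g) {ι : Type*} (s : Finset ι)
    (u : ι → C(X, ℝ)) (hu : ∀ i ∈ s, 0 ≤ u i)
    (hd : (s : Set ι).Pairwise fun i j => u i * u j = 0) :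
    F (∑ i ∈ s, u i) = ∑ i ∈ s, F (u i) := by
  classical
  induction s using Finset.induction_on with
  | empty => simpa using h0
  | insert a s ha ih =>
    have hds : (s : Set ι).Pairwise fun i j => u i * u j = 0 :=
      hd.mono (by simp)
    rw [Finset.sum_insert ha, Finset.sum_insert ha,
      ← ih (fun i hi => hu i (Finset.mem_insert_of_mem hi)) hds]
    have hs : 0 ≤ ∑ i ∈ s, u i :=
      Finset.sum_nonneg fun i hi => hu i (Finset.mem_insert_of_mem hi)
    have ha0 : 0 ≤ u a := hu a (Finset.mem_insert_self _ _)
    have hmul : u a * ∑ i ∈ s, u i = 0 := by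
      rw [Finset.mul_sum]
      refine Finset.sum_eq_zero fun i hi => hd (by simp) (by simp [hi]) ?_
      rintro rfl
      exact ha hi
    have key : ∀ x, u a x = 0 ∨ (∑ i ∈ s, u i) x = 0 := fun x => by
      simpa using DFunLike.congr_fun hmul x
    have e1 : u a ⊔ ∑ i ∈ s, u i = u a + ∑ i ∈ s, u i := by
      ext x
      have h1 : 0 ≤ (∑ i ∈ s, u i) x := hs x
      have h2 : 0 ≤ u a x := ha0 x
      rw [ContinuousMap.sup_apply, ContinuousMap.add_apply]
      rcases key x with h | h
      · rw [h, zero_add, max_eq_right h1]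
      · rw [h, add_zero, max_eq_left h2]
    have e2 : u a ⊓ ∑ i ∈ s, u i = 0 := by
      ext x
      have h1 : 0 ≤ (∑ i ∈ s, u i) x := hs x
      have h2 : 0 ≤ u a x := ha0 x
      rw [ContinuousMap.inf_apply, ContinuousMap.zero_apply]
      rcases key x with h | h
      · rw [h, min_eq_left h1]
      · rw [h, min_eq_right h2]
    have := hval (u a) (∑ i ∈ s, u i)
    rw [e1, e2, h0, add_zero] at this
    exact this

/-- The order interval is not compact, but the constants in it are, so `F` varies by less than 1
within one δ of each of them. Raising the upper bound on f in steps of δ/2 then costs at most 1 per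
step. -/
theorem valuation_abs_le_of_le_const [CompactSpace X] {F : C(X, ℝ) → ℝ} (hF : Continuous F)
    (hval : ∀ f g, F (f ⊔ g) + F (f ⊓ g) = F f + F g) (M : ℝ) :
    ∃ C, ∀ f : C(X, ℝ), 0 ≤ f → f ≤ ContinuousMap.const X M → |F f| ≤ C := by
  have hcomp : IsCompact (ContinuousMap.const X '' Set.Icc (0 : ℝ) M) :=
    isCompact_Icc.image ContinuousMap.continuous_const'
  obtain ⟨δ, hδ, hδF⟩ := Metric.mem_uniformity_dist.1
    (hcomp.uniformContinuousAt_of_continuousAt F (fun _ _ => hF.continuousAt)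
      (Metric.dist_mem_uniformity one_pos))
  replace hδF : ∀ c ∈ Set.Icc (0 : ℝ) M, ∀ f : C(X, ℝ), dist (ContinuousMap.const X c) f < δ →
      |F (ContinuousMap.const X c) - F f| < 1 := fun c hc f hf => hδF hf ⟨c, hc, rfl⟩
  have step : ∀ k : ℕ, ∃ C, ∀ f : C(X, ℝ), 0 ≤ f → f ≤ ContinuousMap.const X M →
      f ≤ ContinuousMap.const X (k * (δ / 2)) → |F f| ≤ C := by
    intro k
    induction k with
    | zero =>
      refine ⟨|F 0|, fun f h1 _ h2 => ?_⟩
      have : f = 0 := le_antisymm (h2.trans (by intro x; simp)) h1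
      rw [this]
    | succ k ih =>
      obtain ⟨C, hC⟩ := ih
      refine ⟨C + 1, fun f h1 h2 h3 => ?_⟩
      by_cases hM : k * (δ / 2) ≤ M
      · have hk : (0 : ℝ) ≤ k * (δ / 2) := by positivity
        have hle : ∀ x, f x ≤ k * (δ / 2) + δ / 2 := fun x => by
          have : f x ≤ ((k + 1 : ℕ) : ℝ) * (δ / 2) := h3 x
          push_cast at this
          linarith
        -- F(f) = F(f ⊓ c) + F(f ⊔ c) − F(c): the first term is bounded by induction, and f ⊔ c is
        -- within δ/2 of c.
        set c := ContinuousMap.const X (k * (δ / 2)) with hc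
        have a1 := hC (f ⊓ c) (le_inf h1 fun x => by simpa [hc] using hk)
          (inf_le_left.trans h2) inf_le_right
        have a2 := hδF _ ⟨hk, hM⟩ (f ⊔ c) (by
          refine lt_of_le_of_lt ((ContinuousMap.dist_le (by positivity)).2 fun x => ?_)
            (half_lt_self hδ)
          rw [Real.dist_eq, abs_le]
          have := hle x
          have h4 := le_max_right (f x) (k * (δ / 2))
          have h5 : max (f x) (k * (δ / 2)) ≤ k * (δ / 2) + δ / 2 := max_le this (by linarith)
          change -(δ / 2) ≤ k * (δ / 2) - max (f x) (k * (δ / 2)) ∧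
            k * (δ / 2) - max (f x) (k * (δ / 2)) ≤ δ / 2
          constructor <;> linarith)
        have a3 := hval f c
        rw [abs_le] at a1 ⊢
        rw [abs_lt] at a2
        constructor <;> linarith
      · refine (hC f h1 h2 (h2.trans fun x => ?_)).trans (by linarith)
        simpa using (not_le.1 hM).le
  obtain ⟨k, hk⟩ := exists_nat_gt (M / (δ / 2))
  obtain ⟨C, hC⟩ := step k
  refine ⟨C, fun f h1 h2 => hC f h1 h2 (h2.trans fun x => ?_)⟩
  rw [div_lt_iff₀ (by positivity)] at hk
  simpa using hk.le

/-- Any subfamily sums to a function still between 0 and M, so its total `F` is at most C in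
absolute value. The subfamilies where `F` is nonnegative and where it is negative contribute C each.
-/
theorem valuation_sum_abs_le [CompactSpace X] {F : C(X, ℝ) → ℝ} (h0 : F 0 = 0)
    (hval : ∀ f g, F (f ⊔ g) + F (f ⊓ g) = F f + F g) {M C : ℝ} (hM : 0 ≤ M)
    (hC : ∀ f : C(X, ℝ), 0 ≤ f → f ≤ ContinuousMap.const X M → |F f| ≤ C)
    {ι : Type*} (s : Finset ι) (u : ι → C(X, ℝ)) (hu : ∀ i ∈ s, 0 ≤ u i)
    (huM : ∀ i ∈ s, u i ≤ ContinuousMap.const X M)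
    (hd : (s : Set ι).Pairwise fun i j => u i * u j = 0) :
    ∑ i ∈ s, |F (u i)| ≤ 2 * C := by
  classical
  have key : ∀ t ⊆ s, |∑ i ∈ t, F (u i)| ≤ C := by
    intro t ht
    have hdt : (t : Set ι).Pairwise fun i j => u i * u j = 0 := hd.mono (by simpa using ht)
    rw [← valuation_sum_of_pairwise_mul_eq_zero h0 hval t u (fun i hi => hu i (ht hi)) hdt]
    refine hC _ (Finset.sum_nonneg fun i hi => hu i (ht hi)) fun x => ?_
    change (∑ i ∈ t, u i) x ≤ M
    rcases ContinuousMap.sum_apply_eq_zero_or_of_pairwise_mul_eq_zero t u hdt x with h | ⟨i, hi, h⟩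
    · rw [ContinuousMap.sum_apply, Finset.sum_eq_zero h]
      exact hM
    · rw [h]
      exact huM i (ht hi) x
  rw [← Finset.sum_filter_add_sum_filter_not s (fun i => 0 ≤ F (u i))]
  have e1 : ∑ i ∈ s with 0 ≤ F (u i), |F (u i)| = ∑ i ∈ s with 0 ≤ F (u i), F (u i) :=
    Finset.sum_congr rfl fun i hi => abs_of_nonneg (Finset.mem_filter.1 hi).2
  have e2 : ∑ i ∈ s with ¬ 0 ≤ F (u i), |F (u i)| = -∑ i ∈ s with ¬ 0 ≤ F (u i), F (u i) := by
    rw [← Finset.sum_neg_distrib]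
    exact Finset.sum_congr rfl fun i hi =>
      abs_of_neg (not_le.1 (Finset.mem_filter.1 hi).2)
  rw [e1, e2]
  have k1 := abs_le.1 (key _ (Finset.filter_subset (fun i => 0 ≤ F (u i)) s))
  have k2 := abs_le.1 (key _ (Finset.filter_subset (fun i => ¬ 0 ≤ F (u i)) s))
  linarith [k1.2, k2.1]

/-- Among many disjoint shells around the level sets of `d`, one is negligible for the valuation. -/
theorem exists_shell_valuation_abs_le [CompactSpace X] {F : C(X, ℝ) → ℝ} (hF : Continuous F)
    (h0 : F 0 = 0) (hval : ∀ f g, F (f ⊔ g) + F (f ⊓ g) = F f + F g) {M : ℝ} (hM : 0 ≤ M)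
    (d : X → ℝ) {a b ε : ℝ} (hab : a < b) (hε : 0 < ε) :
    ∃ r s : ℝ, 0 < s ∧ a ≤ r - s ∧ r + s ≤ b ∧ ∀ u : C(X, ℝ), 0 ≤ u →
      u ≤ ContinuousMap.const X M → (∀ x, s ≤ |d x - r| → u x = 0) → |F u| ≤ ε := by
  obtain ⟨C, hC⟩ := valuation_abs_le_of_le_const hF hval M
  obtain ⟨K, hK⟩ := exists_nat_gt (max (2 * C / ε) 0)
  have hK0 : (0 : ℝ) < K := (le_max_right _ _).trans_lt hK
  have hKε : 2 * C < K * ε := (div_lt_iff₀ hε).1 ((le_max_left _ _).trans_lt hK)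
  -- K shells of half-width w, centred at a + (2k + 1)w, tile [a, b]. If each carried a function
  -- with |F| > ε, their total would exceed Kε > 2C.
  set w : ℝ := (b - a) / (2 * K) with hw
  have hw0 : 0 < w := div_pos (by linarith) (by linarith)
  have hwK : 2 * K * w = b - a := by rw [hw]; field_simp
  by_contra! hcon
  have hcon' : ∀ k : ℕ, k < K → ∃ u : C(X, ℝ), 0 ≤ u ∧ u ≤ ContinuousMap.const X M ∧
      (∀ x, w ≤ |d x - (a + (2 * k + 1) * w)| → u x = 0) ∧ ε < |F u| := by
    intro k hk
    refine hcon (a + (2 * k + 1) * w) w hw0 ?_ ?_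
    · have : 0 ≤ k * w := by positivity
      linarith
    · have : ((k : ℝ) + 1) * w ≤ K * w :=
        mul_le_mul_of_nonneg_right (by exact_mod_cast hk) hw0.le
      linarith
  choose! u hu1 hu2 hu3 hu4 using hcon'
  have hsum := valuation_sum_abs_le h0 hval hM hC (Finset.range K) u
    (fun i hi => hu1 i (Finset.mem_range.1 hi)) (fun i hi => hu2 i (Finset.mem_range.1 hi)) (by
      have aux : ∀ i j, i < K → j < K → i < j → u i * u j = 0 := by
        intro i j hi hj hij
        ext x
        rw [ContinuousMap.mul_apply, ContinuousMap.zero_apply, mul_eq_zero]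
        by_contra! hne
        have h1 : |d x - (a + (2 * i + 1) * w)| < w := by
          by_contra! h
          exact hne.1 (hu3 i hi x h)
        have h2 : |d x - (a + (2 * j + 1) * w)| < w := by
          by_contra! h
          exact hne.2 (hu3 j hj x h)
        have : ((i : ℝ) + 1) * w ≤ j * w :=
          mul_le_mul_of_nonneg_right (by exact_mod_cast hij) hw0.le
        rw [abs_lt] at h1 h2
        linarith [h1.2, h2.1]
      intro i hi j hj hij
      rw [Finset.coe_range, Set.mem_Iio] at hi hj
      rcases lt_or_gt_of_ne hij with h | h
      · exact aux i j hi hj h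
      · rw [mul_comm]
        exact aux j i hj hi h)
  have : ∑ i ∈ Finset.range K, ε ≤ ∑ i ∈ Finset.range K, |F (u i)| :=
    Finset.sum_le_sum fun i hi => (hu4 i (Finset.mem_range.1 hi)).le
  rw [Finset.sum_const, Finset.card_range, nsmul_eq_mul] at this
  linarith

/-- Joining a function with functions in negligible sets hardly changes the valuation. -/
theorem exists_isLUB_valuation_abs_sub_le {F : C(X, ℝ) → ℝ}
    (hval : ∀ f g, F (f ⊔ g) + F (f ⊓ g) = F f + F g) {M ε : ℝ} (h : C(X, ℝ)) (hh : 0 ≤ h)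
    {ι : Type*} (s : Finset ι) (χ : ι → C(X, ℝ)) (hχ : ∀ j, 0 ≤ χ j)
    (hχM : ∀ j, χ j ≤ ContinuousMap.const X M)
    (hsmall : ∀ j, ∀ u : C(X, ℝ), 0 ≤ u → u ≤ ContinuousMap.const X M →
      (∀ x, χ j x = 0 → u x = 0) → |F u| ≤ ε) :
    ∃ H, IsLUB (insert h (χ '' s)) H ∧ |F H - F h| ≤ s.card * (2 * ε) := by
  classical
  induction s using Finset.induction_on with
  | empty => exact ⟨h, by simp, by simp⟩
  | insert j s hj ih =>
    obtain ⟨H, hH, hF⟩ := ih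
    have hH0 : 0 ≤ H := hh.trans (hH.1 (by simp))
    refine ⟨χ j ⊔ H, ?_, ?_⟩
    -- The new join changes `F` by F(χ_j) − F(χ_j ⊓ H), and both functions vanish wherever χ_j does.
    · have := hH.insert (χ j)
      rwa [Finset.coe_insert, Set.image_insert_eq, Set.insert_comm]
    · have a1 := hsmall j (χ j) (hχ j) (hχM j) fun x hx => hx
      have a2 := hsmall j (χ j ⊓ H) (le_inf (hχ j) hH0) (inf_le_left.trans (hχM j)) fun x hx => by
        rw [ContinuousMap.inf_apply, hx]
        exact min_eq_left (hH0 x)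
      have a3 := hval (χ j) H
      rw [Finset.card_insert_of_notMem hj]
      rw [abs_le] at *
      push_cast
      constructor <;> linarith [a1.1, a1.2, a2.1, a2.2, hF.1, hF.2]

/-- A compact metric space splits into small cells, up to a set that is negligible for the
valuation. -/
theorem exists_cells {X : Type*} [PseudoMetricSpace X] [CompactSpace X] {F : C(X, ℝ) → ℝ}
    (hF : Continuous F) (h0 : F 0 = 0) (hval : ∀ f g, F (f ⊔ g) + F (f ⊓ g) = F f + F g)
    {M η ε : ℝ} (hM : 0 ≤ M) (hη : 0 < η) (hε : 0 < ε) :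
    ∃ (N : ℕ) (y : Fin N → X) (g : Fin N → C(X, ℝ)),
      (∀ c : Fin N → ℝ, (∀ j, 0 ≤ c j) → F (∑ j, c j • g j) = ∑ j, F (c j • g j)) ∧
      ∀ (c : Fin N → ℝ) (p : C(X, ℝ)) (δ : ℝ), (∀ j, 0 ≤ c j) → 0 ≤ p →
        p ≤ ContinuousMap.const X M → 0 ≤ δ → (∀ j x, dist x (y j) < η → |p x - c j| ≤ δ) →
        ∃ H : C(X, ℝ), dist H p ≤ δ ∧ |F H - F (∑ j, c j • g j)| ≤ ε := by
  obtain ⟨t, -, htf, ht⟩ := finite_cover_balls_of_compact (isCompact_univ (X := X)) (half_pos hη)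
  lift t to Finset X using htf
  set N := t.card with hN
  set y : Fin N → X := fun j => t.equivFin.symm j with hy
  have hcover : ∀ x, ∃ j, dist x (y j) < η / 2 := by
    intro x
    obtain ⟨z, hz, hxz⟩ := Set.mem_iUnion₂.1 (ht (Set.mem_univ x))
    exact ⟨t.equivFin ⟨z, hz⟩, by simpa [hy] using hxz⟩
  -- Each of the N shells will cost twice this amount; N + 1 also covers N = 0.
  have hε' : 0 < ε / (2 * (N + 1)) := by positivity
  choose r s hs hrs1 hrs2 hsmall using fun j : Fin N =>
    exists_shell_valuation_abs_le hF h0 hval hM (fun x => dist x (y j)) (half_lt_self hη) hε'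
  let τ : C(ℝ, ℝ) := ⟨fun t => max 0 (min 1 t), by fun_prop⟩
  have τ0 : ∀ t, 0 ≤ τ t := fun t => le_max_left _ _
  have τ1 : ∀ t, τ t ≤ 1 := fun t => max_le zero_le_one (min_le_left _ _)
  have τn : ∀ {t}, t ≤ 0 → τ t = 0 := fun {t} h =>
    max_eq_left ((min_le_right _ _).trans h)
  have τp : ∀ {t}, 1 ≤ t → τ t = 1 := fun {t} h => by
    change max 0 (min 1 t) = 1
    rw [min_eq_left h, max_eq_right zero_le_one]
  -- α_j lives inside radius r_j and β_j outside it; each equals 1 on its side once the distance to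
  -- y_j differs from r_j by s_j/2. The cutoff κ_j is 1 on that half shell and 0 off the full shell.
  let α : Fin N → C(X, ℝ) := fun j => τ.comp ⟨fun x => (r j - dist x (y j)) / (s j / 2), by fun_prop⟩
  let β : Fin N → C(X, ℝ) := fun j => τ.comp ⟨fun x => (dist x (y j) - r j) / (s j / 2), by fun_prop⟩
  let κ : Fin N → C(X, ℝ) := fun j =>
    τ.comp ⟨fun x => (s j - |dist x (y j) - r j|) / (s j / 2), by fun_prop⟩
  have hs2 : ∀ j, 0 < s j / 2 := fun j => half_pos (hs j)
  have αβ : ∀ j x, α j x = 0 ∨ β j x = 0 := by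
    intro j x
    rcases le_total (r j) (dist x (y j)) with h | h
    · exact Or.inl (τn (div_nonpos_of_nonpos_of_nonneg (by linarith) (hs2 j).le))
    · exact Or.inr (τn (div_nonpos_of_nonpos_of_nonneg (by linarith) (hs2 j).le))
  have αne : ∀ j x, α j x ≠ 0 → dist x (y j) < η := by
    intro j x h
    by_contra! h'
    exact h (τn (div_nonpos_of_nonpos_of_nonneg (by linarith [hrs2 j, hs j]) (hs2 j).le))
  -- A continuous version of "in ball j but in no earlier ball"; disjointness follows from α_i β_i =
  -- 0.
  let g : Fin N → C(X, ℝ) := fun j => α j * ∏ i ∈ Finset.Iio j, β i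
  have g_apply : ∀ j x, g j x = α j x * ∏ i ∈ Finset.Iio j, β i x := fun j x => by
    simp [g, ContinuousMap.prod_apply]
  have g0 : ∀ j x, 0 ≤ g j x := fun j x => by
    rw [g_apply]
    exact mul_nonneg (τ0 _) (Finset.prod_nonneg fun i _ => τ0 _)
  have g1 : ∀ j x, g j x ≤ 1 := fun j x => by
    rw [g_apply]
    exact mul_le_one₀ (τ1 _) (Finset.prod_nonneg fun i _ => τ0 _)
      (Finset.prod_le_one (fun i _ => τ0 _) fun i _ => τ1 _)
  have gne : ∀ j x, g j x ≠ 0 → dist x (y j) < η := fun j x h => by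
    rw [g_apply] at h
    exact αne j x (left_ne_zero_of_mul h)
  have gdisj' : ∀ i j, i < j → g i * g j = 0 := by
    intro i j hij
    ext x
    rw [ContinuousMap.mul_apply, g_apply, g_apply, ContinuousMap.zero_apply]
    rcases αβ i x with h | h
    · rw [h]; ring
    · rw [Finset.prod_eq_zero (Finset.mem_Iio.2 hij) h]; ring
  have gdisj : ∀ i j, i ≠ j → g i * g j = 0 := by
    intro i j hij
    rcases lt_or_gt_of_ne hij with h | h
    · exact gdisj' i j h
    · rw [mul_comm]
      exact gdisj' j i h
  have gone : ∀ x, (∀ j, s j / 2 ≤ |dist x (y j) - r j|) → ∃ j, g j x = 1 := by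
    intro x hx
    have hαβ1 : ∀ j, α j x = 1 ∨ β j x = 1 := by
      intro j
      rcases le_abs'.1 (hx j) with h | h
      · exact Or.inl (τp ((one_le_div (hs2 j)).2 (by linarith)))
      · exact Or.inr (τp ((one_le_div (hs2 j)).2 h))
    have hex : ∃ j, α j x = 1 := by
      obtain ⟨j, hj⟩ := hcover x
      exact ⟨j, τp ((one_le_div (hs2 j)).2 (by
        rcases le_abs'.1 (hx j) with h | h <;> linarith [hrs1 j, hs j]))⟩
    -- At the first j with α_j = 1, every earlier β_i equals 1.
    obtain ⟨j, hj, hmin⟩ := WellFounded.has_min (wellFounded_lt (α := Fin N))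
      {j | α j x = 1} hex
    refine ⟨j, ?_⟩
    rw [g_apply, hj, one_mul]
    exact Finset.prod_eq_one fun i hi =>
      (hαβ1 i).resolve_left fun h => hmin i h (by simpa using hi)
  have cdisj : ∀ c : Fin N → ℝ, ((Finset.univ : Finset (Fin N)) : Set (Fin N)).Pairwise
      fun i j => (c i • g i) * (c j • g j) = 0 := fun c i _ j _ hij => by
    change (c i • g i) * (c j • g j) = 0
    rw [smul_mul_smul_comm, gdisj i j hij, smul_zero]
  have c0 : ∀ c : Fin N → ℝ, (∀ j, 0 ≤ c j) → ∀ j, 0 ≤ c j • g j := fun c hc j x =>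
    mul_nonneg (hc j) (g0 j x)
  refine ⟨N, y, g, fun c hc => valuation_sum_of_pairwise_mul_eq_zero h0 hval _ _
    (fun j _ => c0 c hc j) (cdisj c), fun c p δ hc hp hpM hδ hpc => ?_⟩
  set h := ∑ j, c j • g j with hh
  have hh0 : 0 ≤ h := Finset.sum_nonneg fun j _ => c0 c hc j
  have hle : ∀ x, h x ≤ p x + δ := by
    intro x
    have hpx : 0 ≤ p x := hp x
    rcases ContinuousMap.sum_apply_eq_zero_or_of_pairwise_mul_eq_zero _ _ (cdisj c) x with
      h1 | ⟨j, -, h1⟩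
    · rw [hh, ContinuousMap.sum_apply, Finset.sum_eq_zero h1]
      linarith
    · rw [hh, h1, ContinuousMap.smul_apply, smul_eq_mul]
      by_cases hg : g j x = 0
      · rw [hg, mul_zero]
        linarith
      · have := (abs_le.1 (hpc j x (gne j x hg))).1
        linarith [mul_le_of_le_one_right (hc j) (g1 j x)]
  have κ0 : ∀ j x, 0 ≤ κ j x := fun j x => τ0 _
  -- Only on the half shells can h fall more than δ below p. Joining h with the functions κ_j p,
  -- each at most p and equal to p on its half shell, repairs this at negligible cost.
  obtain ⟨H, hH, hFH⟩ := exists_isLUB_valuation_abs_sub_le hval (M := M) h hh0 Finset.univ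
    (fun j => κ j * p) (fun j x => mul_nonneg (τ0 _) (hp x))
    (fun j x => (mul_le_of_le_one_left (hp x) (τ1 _)).trans (hpM x))
    (fun j u hu huM hux => hsmall j u hu huM fun x hx => hux x (by
      rw [ContinuousMap.mul_apply]
      have : κ j x = 0 := τn (div_nonpos_of_nonpos_of_nonneg (by linarith) (hs2 j).le)
      rw [this, zero_mul]))
  refine ⟨H, (ContinuousMap.dist_le hδ).2 fun x => ?_, hFH.trans ?_⟩
  · rw [Real.dist_eq, abs_le]
    have hup : H ≤ p + ContinuousMap.const X δ := by
      refine hH.2 ?_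
      rintro _ (rfl | ⟨j, -, rfl⟩)
      · exact hle
      · intro x
        have h1 : κ j x * p x ≤ p x := mul_le_of_le_one_left (hp x) (τ1 _)
        exact h1.trans (le_add_of_nonneg_right hδ)
    have hupx : H x ≤ p x + δ := hup x
    refine ⟨?_, by linarith⟩
    by_cases hx : ∀ j, s j / 2 ≤ |dist x (y j) - r j|
    · obtain ⟨j, hj⟩ := gone x hx
      have h1 : h x = c j := by
        rw [hh, ContinuousMap.sum_apply, Finset.sum_eq_single_of_mem j (Finset.mem_univ j)]
        · rw [ContinuousMap.smul_apply, hj, smul_eq_mul, mul_one]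
        · intro i _ hij
          have := DFunLike.congr_fun (gdisj i j hij) x
          rw [ContinuousMap.mul_apply, hj, mul_one, ContinuousMap.zero_apply] at this
          rw [ContinuousMap.smul_apply, this, smul_zero]
      have h2 : h x ≤ H x := hH.1 (Set.mem_insert _ _) x
      have h3 := (abs_le.1 (hpc j x (gne j x (by rw [hj]; exact one_ne_zero)))).2
      linarith
    · push Not at hx
      obtain ⟨j, hj⟩ := hx
      have h1 : κ j x * p x ≤ H x :=
        hH.1 (Set.mem_insert_of_mem _ ⟨j, by simp, rfl⟩) x
      have h2 : κ j x = 1 := τp ((one_le_div (hs2 j)).2 (by linarith))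
      rw [h2, one_mul] at h1
      linarith
  · rw [Finset.card_univ, Fintype.card_fin]
    have : (N : ℝ) * (2 * (ε / (2 * (N + 1)))) = ε * (N / (N + 1)) := by field_simp
    rw [this]
    exact mul_le_of_le_one_right hε.le ((div_le_one (by positivity)).2 (by linarith))

end Valuation

/-! ### Averaging over a compact transitive group -/

section Averaging

variable {X G : Type*} [Group G] [TopologicalSpace G] [IsTopologicalGroup G] [CompactSpace G]

/-- By transitivity and left invariance of μ, the orbit average does not depend on the base point.
Integrating it over the base point and exchanging the integrals leaves the m-integral of h. -/
theorem integral_inv_smul_haar_eq_integral [TopologicalSpace X] [CompactSpace X]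
    [MeasurableSpace X] [BorelSpace X] [MeasurableSpace G] [BorelSpace G] [MulAction G X]
    [ContinuousSMul G X] [MulAction.IsPretransitive G X] (m : Measure X) [IsProbabilityMeasure m]
    (hm : ∀ (φ : G) (h : C(X, ℝ)), ∫ x, h (φ • x) ∂m = ∫ x, h x ∂m) (μ : Measure G)
    [IsProbabilityMeasure μ] [μ.IsMulLeftInvariant] (h : C(X, ℝ)) (y : X) :
    ∫ φ, h (φ⁻¹ • y) ∂μ = ∫ x, h x ∂m := by
  have hconst : ∀ z, ∫ φ, h (φ⁻¹ • z) ∂μ = ∫ φ, h (φ⁻¹ • y) ∂μ := by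
    intro z
    obtain ⟨ψ, rfl⟩ := MulAction.exists_smul_eq G y z
    have := integral_mul_left_eq_self (μ := μ) (fun φ => h (φ⁻¹ • y)) ψ⁻¹
    simpa [mul_smul] using this
  calc ∫ φ, h (φ⁻¹ • y) ∂μ = ∫ z, ∫ φ, h (φ⁻¹ • z) ∂μ ∂m := by simp [hconst]
    _ = ∫ φ, ∫ z, h (φ⁻¹ • z) ∂m ∂μ :=
      integral_integral_swap_of_hasCompactSupport (f := fun z (φ : G) => h (φ⁻¹ • z))
        (by simp only [Function.uncurry_def]; fun_prop) (HasCompactSupport.of_compactSpace _)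
    _ = ∫ x, h x ∂m := by simp [hm]

variable [PseudoMetricSpace X] [CompactSpace X] [MeasurableSpace X] [BorelSpace X] [MulAction G X]
  [ContinuousSMul G X] [IsIsometricSMul G X] [MulAction.IsPretransitive G X]

/-- The function `x ↦ f (φ • x)`. -/
def ContinuousMap.compSMul (φ : G) (f : C(X, ℝ)) : C(X, ℝ) :=
  f.comp ⟨fun x => φ • x, continuous_const_smul φ⟩

/-- Both sides are compared with ∫ ∑ T_j dm: the left within 2ε/3, by averaging over the group, and
the right within ε/3, pointwise in x. -/
theorem valuation_eq_integral (m : Measure X) [IsProbabilityMeasure m]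
    (hm : ∀ (φ : G) (h : C(X, ℝ)), ∫ x, h (φ • x) ∂m = ∫ x, h x ∂m)
    {F : C(X, ℝ) → ℝ} (hF : Continuous F) (h0 : F 0 = 0)
    (hval : ∀ f g, F (f ⊔ g) + F (f ⊓ g) = F f + F g)
    (hinv : ∀ (φ : G) f, F (f.compSMul φ) = F f) (f : C(X, ℝ)) (hf : 0 ≤ f) :
    F f = ∫ x, F (ContinuousMap.const X (f x)) ∂m := by
  borelize G
  let μ : Measure G := Measure.haarMeasure ⊤
  have hμ : IsProbabilityMeasure μ := ⟨Measure.haarMeasure_self (K₀ := ⊤)⟩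
  have hint : ∀ h : C(X, ℝ), Integrable h m := fun h =>
    h.continuous.integrable_of_hasCompactSupport (HasCompactSupport.of_compactSpace _)
  have hcontF : Continuous fun c => F (ContinuousMap.const X c) :=
    hF.comp ContinuousMap.continuous_const'
  obtain ⟨M, hfM⟩ : ∃ M, ∀ x, f x ≤ M := ⟨‖f‖, fun x => (le_abs_self _).trans (f.norm_coe_le_norm x)⟩
  obtain ⟨x₀⟩ : Nonempty X := by
    by_contra h
    rw [not_nonempty_iff] at h
    have : m Set.univ = 0 := by simp [Set.eq_empty_of_isEmpty]
    simp at this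
  have hfx : ∀ x, 0 ≤ f x := hf
  have hM : 0 ≤ M := (hfx x₀).trans (hfM x₀)
  refine eq_of_abs_sub_le_all fun ε hε => ?_
  obtain ⟨δ, hδ, hδF⟩ := Metric.continuous_iff.1 hF f (ε / 3) (by positivity)
  obtain ⟨η, hη, hηf⟩ := Metric.uniformContinuous_iff.1
    (CompactSpace.uniformContinuous_of_continuous f.continuous) (δ / 2) (half_pos hδ)
  obtain ⟨N, y, g, hsum, happ⟩ := exists_cells hF h0 hval hM hη (show 0 < ε / 3 by positivity)
  let T : Fin N → C(X, ℝ) := fun j => ⟨fun x => F (f x • g j), by fun_prop⟩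
  have hrot : ∀ φ : G, |F f - ∑ j, T j (φ⁻¹ • y j)| ≤ 2 * (ε / 3) := by
    intro φ
    -- Since the action is isometric, the same η, hence the same cells, serve all translates of f.
    obtain ⟨H, hH1, hH2⟩ := happ (fun j => f (φ⁻¹ • y j)) (f.compSMul φ⁻¹) (δ / 2)
      (fun j => hfx _) (fun x => hf (φ⁻¹ • x)) (fun x => hfM _) (half_pos hδ).le (fun j x hx => by
        have := hηf (a := φ⁻¹ • x) (b := φ⁻¹ • y j) (by rwa [dist_smul])
        exact this.le)
    rw [hsum _ fun j => hfx _] at hH2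
    have h1 : dist (H.compSMul φ) f ≤ δ / 2 := by
      refine (ContinuousMap.dist_le (half_pos hδ).le).2 fun x => ?_
      have := (ContinuousMap.dist_le (half_pos hδ).le).1 hH1 (φ • x)
      simpa [ContinuousMap.compSMul] using this
    have h2 := hδF _ (h1.trans_lt (half_lt_self hδ))
    rw [hinv, Real.dist_eq] at h2
    change |F H - ∑ j, T j (φ⁻¹ • y j)| ≤ _ at hH2
    rw [abs_lt] at h2
    rw [abs_le] at hH2 ⊢
    constructor <;> linarith [h2.1, h2.2, hH2.1, hH2.2]
  have hconst : ∀ x, |F (ContinuousMap.const X (f x)) - ∑ j, T j x| ≤ ε / 3 := by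
    intro x
    -- A constant has no oscillation, so δ = 0 is allowed and H is the constant itself.
    obtain ⟨H, hH1, hH2⟩ := happ (fun _ => f x) (ContinuousMap.const X (f x)) 0
      (fun j => hfx _) (fun _ => hf x) (fun _ => hfM x) le_rfl (fun j z hz => by simp)
    rw [hsum _ fun j => hfx _, dist_le_zero.1 hH1] at hH2
    exact hH2
  have hintG : ∀ j, Integrable (fun φ : G => T j (φ⁻¹ • y j)) μ := fun j =>
    (show Continuous fun φ : G => T j (φ⁻¹ • y j) by fun_prop).integrable_of_hasCompactSupport
      (HasCompactSupport.of_compactSpace _)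
  have e1 : ∫ φ : G, ∑ j, T j (φ⁻¹ • y j) ∂μ = ∫ x, ∑ j, T j x ∂m := by
    rw [integral_finsetSum _ fun j _ => hintG j, integral_finsetSum _ fun j _ => hint (T j)]
    exact Finset.sum_congr rfl fun j _ => integral_inv_smul_haar_eq_integral m hm μ (T j) (y j)
  have b1 : |F f - ∫ x, ∑ j, T j x ∂m| ≤ 2 * (ε / 3) := by
    have : F f - ∫ x, ∑ j, T j x ∂m = ∫ φ : G, (F f - ∑ j, T j (φ⁻¹ • y j)) ∂μ := by
      rw [integral_sub (integrable_const _) (integrable_finsetSum _ fun j _ => hintG j), e1]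
      simp
    rw [this]
    simpa only [Real.norm_eq_abs, probReal_univ, mul_one] using
      norm_integral_le_of_norm_le_const (μ := μ)
        (f := fun φ : G => F f - ∑ j, T j (φ⁻¹ • y j)) (Filter.Eventually.of_forall hrot)
  have b2 : |∫ x, F (ContinuousMap.const X (f x)) ∂m - ∫ x, ∑ j, T j x ∂m| ≤ ε / 3 := by
    have hi : Integrable (fun x => F (ContinuousMap.const X (f x))) m :=
      hint ⟨_, hcontF.comp f.continuous⟩
    rw [← integral_sub hi (integrable_finsetSum _ fun j _ => hint (T j))]
    simpa only [Real.norm_eq_abs, probReal_univ, mul_one] using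
      norm_integral_le_of_norm_le_const (μ := m)
        (f := fun x => F (ContinuousMap.const X (f x)) - ∑ j, T j x)
        (Filter.Eventually.of_forall hconst)
  rw [abs_le] at *
  constructor <;> linarith [b1.1, b1.2, b2.1, b2.2]

end Averaging

/-! ### The special orthogonal group and the surface measure -/

section Rotations

/-- The special orthogonal group, as a subgroup of the unitary operators of Euclidean space. -/
noncomputable def rotationSubgroup (n : ℕ) : Subgroup (unitary (Euc n →L[ℝ] Euc n)) :=
  MonoidHom.ker ((LinearMap.det.comp
    (ContinuousLinearMap.toLinearMapRingHom : (Euc n →L[ℝ] Euc n) →+* _).toMonoidHom).comp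
      (unitary (Euc n →L[ℝ] Euc n)).subtype)

/-- The special orthogonal group. -/
def Rotation (n : ℕ) : Type := rotationSubgroup n

namespace Rotation

noncomputable instance (n : ℕ) : Group (Rotation n) := inferInstanceAs (Group (rotationSubgroup n))

instance (n : ℕ) : TopologicalSpace (Rotation n) :=
  inferInstanceAs (TopologicalSpace (rotationSubgroup n))

instance (n : ℕ) : ContinuousStar (Euc n →L[ℝ] Euc n) :=
  ⟨(ContinuousLinearMap.adjoint (𝕜 := ℝ) (E := Euc n) (F := Euc n)).continuous⟩

instance (n : ℕ) : IsTopologicalGroup (Rotation n) :=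
  inferInstanceAs (IsTopologicalGroup (rotationSubgroup n))

/-- A rotation as a linear isometry. -/
noncomputable def isometryEquiv (n : ℕ) : Rotation n →* (Euc n ≃ₗᵢ[ℝ] Euc n) :=
  (Unitary.linearIsometryEquiv : unitary (Euc n →L[ℝ] Euc n) ≃* _).toMonoidHom.comp
    (rotationSubgroup n).subtype

theorem det_isometryEquiv {n : ℕ} (φ : Rotation n) :
    LinearMap.det ((isometryEquiv n φ).toLinearEquiv : Euc n →ₗ[ℝ] Euc n) = 1 :=
  φ.2

theorem exists_isometryEquiv_eq {n : ℕ} (φ : Euc n ≃ₗᵢ[ℝ] Euc n)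
    (hφ : LinearMap.det (φ.toLinearEquiv : Euc n →ₗ[ℝ] Euc n) = 1) :
    ∃ ψ, isometryEquiv n ψ = φ :=
  ⟨⟨Unitary.linearIsometryEquiv.symm φ, hφ⟩, Unitary.linearIsometryEquiv.apply_symm_apply φ⟩

theorem isCompact_unitary (n : ℕ) :
    IsCompact (unitary (Euc n →L[ℝ] Euc n) : Set (Euc n →L[ℝ] Euc n)) := by
  refine Metric.isCompact_of_isClosed_isBounded ?_ ?_
  · have : (unitary (Euc n →L[ℝ] Euc n) : Set (Euc n →L[ℝ] Euc n)) =
        {A | star A * A = 1} ∩ {A | A * star A = 1} := by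
      ext A
      exact Unitary.mem_iff
    rw [this]
    exact (isClosed_eq (by fun_prop) continuous_const).inter
      (isClosed_eq (by fun_prop) continuous_const)
  · refine isBounded_iff_forall_norm_le.2 ⟨1, fun A hA => ?_⟩
    refine A.opNorm_le_bound zero_le_one fun x => ?_
    rw [A.norm_map_of_mem_unitary hA, one_mul]

instance (n : ℕ) : CompactSpace (Rotation n) := by
  have : CompactSpace (unitary (Euc n →L[ℝ] Euc n)) :=
    isCompact_iff_compactSpace.1 (isCompact_unitary n)
  have h : ((rotationSubgroup n : Set (unitary (Euc n →L[ℝ] Euc n)))) =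
      {A | ContinuousLinearMap.det A.1 = 1} := rfl
  have hclosed : IsClosed (rotationSubgroup n : Set (unitary (Euc n →L[ℝ] Euc n))) := by
    rw [h]
    exact isClosed_eq (ContinuousLinearMap.continuous_det.comp continuous_subtype_val)
      continuous_const
  exact isCompact_iff_compactSpace.1 hclosed.isCompact

noncomputable instance (n : ℕ) : MulAction (Rotation n) (USphere n) where
  smul φ t := ⟨isometryEquiv n φ t, by simp⟩
  one_smul _ := rfl
  mul_smul _ _ _ := rfl

instance (n : ℕ) : ContinuousSMul (Rotation n) (USphere n) where
  continuous_smul := by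
    have h : Continuous fun φ : Rotation n => (φ.1.1 : Euc n →L[ℝ] Euc n) :=
      continuous_subtype_val.comp continuous_subtype_val
    refine Continuous.subtype_mk (f := fun p : Rotation n × USphere n =>
      (p.1.1.1 : Euc n →L[ℝ] Euc n) (p.2 : Euc n)) ?_ _
    exact (h.comp continuous_fst).clm_apply (continuous_subtype_val.comp continuous_snd)

instance (n : ℕ) : IsIsometricSMul (Rotation n) (USphere n) where
  isometry_smul φ := Isometry.of_dist_eq fun s t => (isometryEquiv n φ).dist_map s t

/-- For s ≠ t, the reflection exchanging s and t has determinant −1. Composing it with the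
reflection in the hyperplane orthogonal to some nonzero w ⊥ t fixes the sign without moving t; such
a w exists because n ≥ 2. -/
theorem isPretransitive {n : ℕ} (hn : 2 ≤ n) : MulAction.IsPretransitive (Rotation n) (USphere n) where
  exists_smul_eq s t := by
    suffices h : ∃ φ : Euc n ≃ₗᵢ[ℝ] Euc n,
        LinearMap.det (φ.toLinearEquiv : Euc n →ₗ[ℝ] Euc n) = 1 ∧ φ s = t by
      obtain ⟨φ, hφ, hst⟩ := h
      obtain ⟨ψ, rfl⟩ := exists_isometryEquiv_eq φ hφ
      exact ⟨ψ, Subtype.ext hst⟩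
    by_cases hst : s = t
    · subst hst
      exact ⟨LinearIsometryEquiv.refl ℝ _, LinearMap.det_id, rfl⟩
    have hv : (s : Euc n) - t ≠ 0 := sub_ne_zero.2 fun h => hst (Subtype.ext h)
    have hrank : ∀ v : Euc n, v ≠ 0 →
        LinearMap.det ((ℝ ∙ v)ᗮ.reflection.toLinearEquiv : Euc n →ₗ[ℝ] Euc n) = -1 := by
      intro v hv
      have := (ℝ ∙ v)ᗮ.det_reflection
      rw [Submodule.orthogonal_orthogonal, finrank_span_singleton hv, pow_one] at this
      exact this
    obtain ⟨w, hw, hw0⟩ : ∃ w ∈ (ℝ ∙ (t : Euc n))ᗮ, w ≠ 0 := by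
      refine Submodule.exists_mem_ne_zero_of_ne_bot fun h => ?_
      have h1 := Submodule.finrank_add_finrank_orthogonal (ℝ ∙ (t : Euc n))
      have h2 := finrank_span_le_card (R := ℝ) {(t : Euc n)}
      rw [h, finrank_bot, finrank_euclideanSpace_fin] at h1
      simp at h2
      omega
    refine ⟨(ℝ ∙ ((s : Euc n) - t))ᗮ.reflection.trans (ℝ ∙ w)ᗮ.reflection, ?_, ?_⟩
    · have : (((ℝ ∙ ((s : Euc n) - t))ᗮ.reflection.trans (ℝ ∙ w)ᗮ.reflection).toLinearEquiv :
          Euc n →ₗ[ℝ] Euc n) = ((ℝ ∙ w)ᗮ.reflection.toLinearEquiv : Euc n →ₗ[ℝ] Euc n) ∘ₗ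
          ((ℝ ∙ ((s : Euc n) - t))ᗮ.reflection.toLinearEquiv : Euc n →ₗ[ℝ] Euc n) := rfl
      rw [this, LinearMap.det_comp, hrank _ hw0, hrank _ hv]
      norm_num
    · rw [LinearIsometryEquiv.trans_apply, Submodule.reflection_sub (by simp)]
      refine Submodule.reflection_mem_subspace_eq_self ?_
      rw [Submodule.mem_orthogonal_singleton_iff_inner_right] at hw ⊢
      rw [real_inner_comm]
      exact hw

end Rotation

open scoped Pointwise in
theorem measurePreserving_toSphere {n : ℕ} (φ : Euc n ≃ₗᵢ[ℝ] Euc n) :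
    MeasurePreserving (fun t : USphere n => (⟨φ t, by simp⟩ : USphere n))
      (volume : Measure (Euc n)).toSphere (volume : Measure (Euc n)).toSphere := by
  have hc : Continuous fun t : USphere n => (⟨φ t, by simp⟩ : USphere n) :=
    Continuous.subtype_mk (φ.continuous.comp continuous_subtype_val) _
  refine ⟨hc.measurable, Measure.ext fun s hs => ?_⟩
  rw [Measure.map_apply hc.measurable hs, Measure.toSphere_apply' _ (hc.measurable hs),
    Measure.toSphere_apply' _ hs]
  congr 1
  -- Surface measure is a multiple of the volume of the cone over a set, and taking cones commutes
  -- with φ.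
  have : φ ⁻¹' (Set.Ioo (0 : ℝ) 1 • ((↑) '' s : Set (Euc n))) = Set.Ioo (0 : ℝ) 1 •
      ((↑) '' ((fun t : USphere n => (⟨φ t, by simp⟩ : USphere n)) ⁻¹' s) : Set (Euc n)) := by
    ext x
    simp only [Set.mem_preimage, Set.mem_smul, Set.mem_image]
    constructor
    · rintro ⟨c, hc, _, ⟨t, ht, rfl⟩, h⟩
      refine ⟨c, hc, φ.symm t, ⟨⟨φ.symm t, by simp⟩, by simpa using ht, rfl⟩, ?_⟩
      rw [← map_smul, h, φ.symm_apply_apply]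
    · rintro ⟨c, hc, _, ⟨t, ht, rfl⟩, h⟩
      exact ⟨c, hc, _, ⟨_, ht, rfl⟩, by rw [← h, map_smul]⟩
  rw [← this]
  exact φ.measurePreserving.measure_preimage_equiv (f := φ.toMeasurableEquiv) _

theorem isProbabilityMeasure_sphereMeasure {n : ℕ} (hn : 2 ≤ n) :
    IsProbabilityMeasure (sphereMeasure n) := by
  have : Nontrivial (Euc n) := Module.nontrivial_of_finrank_pos (R := ℝ) (by
    rw [finrank_euclideanSpace_fin]; omega)
  refine ⟨?_⟩
  rw [sphereMeasure, Measure.smul_apply, smul_eq_mul]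
  refine ENNReal.inv_mul_cancel ?_ (measure_ne_top _ _)
  rw [Ne, Measure.measure_univ_eq_zero]
  exact Measure.toSphere_ne_zero _

theorem integral_sphereMeasure_comp_isometry {n : ℕ} (φ : Euc n ≃ₗᵢ[ℝ] Euc n)
    (h : USphere n → ℝ) (hh : Continuous h) :
    ∫ t, h ⟨φ t, by simp⟩ ∂(sphereMeasure n) = ∫ t, h t ∂(sphereMeasure n) := by
  have hp := measurePreserving_toSphere φ
  rw [sphereMeasure, integral_smul_measure, integral_smul_measure]
  congr 1
  conv_rhs => rw [← hp.map_eq]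
  exact (integral_map hp.measurable.aemeasurable hh.aestronglyMeasurable).symm

end Rotations

/-! ### Star bodies as nonnegative continuous functions -/

namespace StarBody

variable {n : ℕ}

/-- The radial function of a star body, as a bundled continuous function. -/
noncomputable def radial (K : StarBody n) : C(USphere n, ℝ) :=
  ⟨radialFun K.carrier, K.continuous_radialFun⟩

/-- The star body whose radial function is the positive part of `f`. -/
def ofRadial (f : C(USphere n, ℝ)) : StarBody n where
  carrier := starSetOf (f ⊔ 0 : C(USphere n, ℝ))
  isStarSet := isStarSet_starSetOf fun _ => le_max_right _ _
  continuous_radialFun := by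
    rw [radialFun_starSetOf (f := (f ⊔ 0 : C(USphere n, ℝ))) fun _ => le_max_right _ _]
    exact (f ⊔ 0).continuous

theorem radial_nonneg (K : StarBody n) (t : USphere n) : 0 ≤ K.radial t := radialFun_nonneg _ t

theorem carrier_eq (K : StarBody n) : K.carrier = starSetOf K.radial :=
  eq_starSetOf (radialFun_nonneg _) K.isStarSet.1 fun t _ hc => K.isStarSet.smul_mem_iff t hc

theorem radial_injective : Function.Injective (radial : StarBody n → C(USphere n, ℝ)) := by
  intro K L h
  have : K.carrier = L.carrier := by rw [K.carrier_eq, L.carrier_eq, h]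
  cases K
  cases L
  congr

theorem radial_ofRadial (f : C(USphere n, ℝ)) : (ofRadial f).radial = f ⊔ 0 :=
  DFunLike.coe_injective (radialFun_starSetOf fun _ => le_max_right _ _)

theorem ofRadial_radial (K : StarBody n) : ofRadial K.radial = K :=
  radial_injective (by rw [radial_ofRadial, sup_eq_left.2 fun t => K.radial_nonneg t])

theorem radial_union (K L : StarBody n) : (K ∪ L).radial = K.radial ⊔ L.radial := by
  refine DFunLike.coe_injective ?_
  change radialFun (K.carrier ∪ L.carrier) = _
  rw [K.union_eq L, radialFun_starSetOf fun t => le_max_of_le_left (radialFun_nonneg _ t)]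
  rfl

theorem radial_inter (K L : StarBody n) : (K ∩ L).radial = K.radial ⊓ L.radial := by
  refine DFunLike.coe_injective ?_
  change radialFun (K.carrier ∩ L.carrier) = _
  rw [K.inter_eq L,
    radialFun_starSetOf fun t => le_min (radialFun_nonneg _ t) (radialFun_nonneg _ t)]
  rfl

theorem radial_map_apply (φ : Euc n ≃ₗᵢ[ℝ] Euc n) (K : StarBody n) (t : USphere n) :
    (K.map φ).radial t = K.radial ⟨φ.symm t, by simp⟩ := by
  change radialFun (φ '' K.carrier) t = _
  rw [K.image_eq φ, radialFun_starSetOf fun t => radialFun_nonneg _ _]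
  rfl

theorem ofRadial_union (f g : C(USphere n, ℝ)) :
    ofRadial f ∪ ofRadial g = ofRadial (f ⊔ g) :=
  radial_injective (by
    rw [radial_union, radial_ofRadial, radial_ofRadial, radial_ofRadial, ← sup_sup_distrib_right])

theorem ofRadial_inter (f g : C(USphere n, ℝ)) :
    ofRadial f ∩ ofRadial g = ofRadial (f ⊓ g) :=
  radial_injective (by
    ext t
    simp only [radial_inter, radial_ofRadial, ContinuousMap.inf_apply, ContinuousMap.sup_apply,
      sup_inf_right])

theorem map_ofRadial_compSMul (φ : Rotation n) (f : C(USphere n, ℝ)) :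
    (ofRadial (f.compSMul φ)).map (Rotation.isometryEquiv n φ) = ofRadial f := by
  refine radial_injective ?_
  ext t
  rw [radial_map_apply, radial_ofRadial, radial_ofRadial, ContinuousMap.sup_apply,
    ContinuousMap.sup_apply]
  have : φ • (⟨(Rotation.isometryEquiv n φ).symm t, by simp⟩ : USphere n) = t :=
    Subtype.ext ((Rotation.isometryEquiv n φ).apply_symm_apply t)
  change max (f (φ • _)) _ = max (f t) _
  rw [this]
  rfl

theorem carrier_subset_starSetOf_iff (K : StarBody n) {f : USphere n → ℝ} (hf : ∀ t, 0 ≤ f t) :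
    K.carrier ⊆ starSetOf f ↔ ∀ t, K.radial t ≤ f t := by
  constructor
  · intro h t
    rw [← smul_mem_starSetOf_iff hf t (K.radial_nonneg t)]
    exact h ((K.isStarSet.smul_mem_iff t (K.radial_nonneg t)).2 le_rfl)
  · intro h x hx
    by_cases hx0 : x = 0
    · exact Or.inl hx0
    · obtain ⟨t, c, hc, rfl⟩ := exists_polar hx0
      rw [smul_mem_starSetOf_iff hf t hc.le]
      exact ((K.isStarSet.smul_mem_iff t hc.le).1 hx).trans (h t)

theorem carrier_subset_radialSum_closedBall_iff (K L : StarBody n) {r : ℝ} (hr : 0 ≤ r) :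
    K.carrier ⊆ radialSum L.carrier (Metric.closedBall 0 r) ↔
      ∀ t, K.radial t ≤ L.radial t + r := by
  have hball : ∀ t, radialFun (Metric.closedBall (0 : Euc n) r) t = r := fun t => by
    have : {c : ℝ | 0 ≤ c ∧ c • (t : Euc n) ∈ Metric.closedBall (0 : Euc n) r} =
        Set.Icc 0 r := by
      ext c
      simp only [Set.mem_ofPred_eq, Set.mem_Icc, mem_closedBall_zero_iff, norm_smul,
        norm_eq_of_mem_sphere, mul_one]
      exact and_congr_right fun hc => by rw [Real.norm_of_nonneg hc]
    rw [radialFun, this, csSup_Icc hr]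
  rw [radialSum, K.carrier_subset_starSetOf_iff
    fun t => add_nonneg (radialFun_nonneg _ t) (radialFun_nonneg _ t)]
  simp only [hball]
  rfl

/-- The two inclusions say that the radial functions differ by at most r everywhere, so the
admissible r form the half-line starting at the sup distance. -/
theorem radialDist_eq_dist (K L : StarBody n) : radialDist K L = dist K.radial L.radial := by
  have : {r : ℝ | 0 ≤ r ∧ K.carrier ⊆ radialSum L.carrier (Metric.closedBall 0 r) ∧
      L.carrier ⊆ radialSum K.carrier (Metric.closedBall 0 r)} =
        Set.Ici (dist K.radial L.radial) := by
    ext r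
    rw [Set.mem_ofPred_eq, Set.mem_Ici]
    constructor
    · rintro ⟨hr, h1, h2⟩
      rw [carrier_subset_radialSum_closedBall_iff _ _ hr] at h1 h2
      refine (ContinuousMap.dist_le hr).2 fun t => ?_
      rw [Real.dist_eq, abs_le]
      constructor <;> linarith [h1 t, h2 t]
    · intro h
      have hr := dist_nonneg.trans h
      rw [carrier_subset_radialSum_closedBall_iff _ _ hr,
        carrier_subset_radialSum_closedBall_iff _ _ hr]
      have key := fun t => abs_le.1 ((ContinuousMap.dist_le hr).1 h t)
      exact ⟨hr, fun t => by linarith [(key t).2], fun t => by linarith [(key t).1]⟩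
  rw [radialDist, this, csInf_Ici]

theorem continuous_comp_ofRadial {V : StarBody n → ℝ} (hV : IsRadialContinuous V) :
    Continuous fun f => V (ofRadial f) := by
  refine Metric.continuous_iff.2 fun f ε hε => ?_
  obtain ⟨δ, hδ, h⟩ := hV (ofRadial f) ε hε
  refine ⟨δ, hδ, fun g hg => h _ (lt_of_le_of_lt ?_ hg)⟩
  rw [radialDist_eq_dist, radial_ofRadial, radial_ofRadial, dist_comm]
  refine (ContinuousMap.dist_le dist_nonneg).2 fun t => ?_
  refine le_trans ?_ (ContinuousMap.dist_apply_le_dist t)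
  -- Taking positive parts is 1-Lipschitz.
  exact abs_max_sub_max_le_abs (g t) (f t) 0

theorem isRadialContinuous_comp_radial {F : C(USphere n, ℝ) → ℝ} (hF : Continuous F) :
    IsRadialContinuous fun K : StarBody n => F K.radial := by
  intro K ε hε
  obtain ⟨δ, hδ, h⟩ := Metric.continuous_iff.1 hF K.radial ε hε
  refine ⟨δ, hδ, fun L hL => h _ ?_⟩
  rwa [dist_comm, ← radialDist_eq_dist]

end StarBody

/-! ### Integration on compact spaces and the representation theorem -/

theorem ContinuousMap.integrable_of_compactSpace {X : Type*} [TopologicalSpace X] [CompactSpace X]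
    [MeasurableSpace X] [BorelSpace X] (m : Measure X) [IsFiniteMeasure m] (f : C(X, ℝ)) :
    Integrable f m :=
  f.continuous.integrable_of_hasCompactSupport (HasCompactSupport.of_compactSpace _)

theorem ContinuousMap.continuous_integral {X : Type*} [TopologicalSpace X] [CompactSpace X]
    [MeasurableSpace X] [BorelSpace X] (m : Measure X) [IsProbabilityMeasure m] :
    Continuous fun f : C(X, ℝ) => ∫ x, f x ∂m := by
  refine (LipschitzWith.of_dist_le_mul (K := 1) fun f g => ?_).continuous
  rw [dist_eq_norm, ← integral_sub (f.integrable_of_compactSpace m)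
    (g.integrable_of_compactSpace m), NNReal.coe_one, one_mul]
  have := norm_integral_le_of_norm_le_const (μ := m) (f := fun x => f x - g x) (C := dist f g)
    (Filter.Eventually.of_forall fun x => by
      rw [← dist_eq_norm]
      exact ContinuousMap.dist_apply_le_dist x)
  simpa only [probReal_univ, mul_one] using this

theorem corollary1p2 (n : ℕ) (hn : 2 ≤ n) :
    (∀ V : StarBody n → ℝ, IsValuation V → IsRadialContinuous V → IsRotationInvariant V →
      ∃ θ : ℝ → ℝ, ContinuousOn θ (Set.Ici 0) ∧
        ∀ K : StarBody n, V K = ∫ t, θ (radialFun K.carrier t) ∂(sphereMeasure n)) ∧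
    (∀ θ : ℝ → ℝ, ContinuousOn θ (Set.Ici 0) →
      IsValuation (fun K : StarBody n => ∫ t, θ (radialFun K.carrier t) ∂(sphereMeasure n)) ∧
      IsRadialContinuous
        (fun K : StarBody n => ∫ t, θ (radialFun K.carrier t) ∂(sphereMeasure n)) ∧
      IsRotationInvariant
        (fun K : StarBody n => ∫ t, θ (radialFun K.carrier t) ∂(sphereMeasure n))) := by
  have hprob := isProbabilityMeasure_sphereMeasure hn
  have htrans := Rotation.isPretransitive hn
  refine ⟨fun V hval hcont hrot => ?_, fun θ hθ => ?_⟩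
  · have hVc := StarBody.continuous_comp_ofRadial hcont
    have hθc : Continuous fun c : ℝ => V (.ofRadial (.const _ c)) :=
      hVc.comp ContinuousMap.continuous_const'
    refine ⟨fun c => V (.ofRadial (.const _ c)), hθc.continuousOn, fun K => ?_⟩
    -- Subtracting the value at {0} normalizes `F` to F(0) = 0; since the measure has mass one, this
    -- constant cancels on both sides at the end.
    have key := valuation_eq_integral (G := Rotation n) (sphereMeasure n)
      (fun φ h => integral_sphereMeasure_comp_isometry (Rotation.isometryEquiv n φ) h h.continuous)
      (F := fun f => V (.ofRadial f) - V (.ofRadial 0)) (hVc.sub continuous_const) (sub_self _)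
      (fun f g => by
        have := hval (.ofRadial f) (.ofRadial g)
        rw [StarBody.ofRadial_union, StarBody.ofRadial_inter] at this
        linarith)
      (fun φ f => by
        rw [← hrot _ φ.det_isometryEquiv (.ofRadial (f.compSMul φ)),
          StarBody.map_ofRadial_compSMul])
      K.radial fun t => K.radial_nonneg t
    have hint : Integrable (fun t => V (.ofRadial (.const _ (K.radial t)))) (sphereMeasure n) :=
      ContinuousMap.integrable_of_compactSpace _ ⟨_, hθc.comp K.radial.continuous⟩
    rw [integral_sub hint (integrable_const _), StarBody.ofRadial_radial] at key
    change V K = ∫ t, V (.ofRadial (.const _ (K.radial t))) ∂(sphereMeasure n)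
    simpa using key
  -- θ is controlled only on [0, ∞); extending it by θ(0) makes it continuous on ℝ without changing
  -- the integrals.
  · let θ' : C(ℝ, ℝ) := ⟨fun c => θ (max c 0), hθ.comp_continuous (by fun_prop)
      fun c => le_max_right c 0⟩
    have heq : ∀ K : StarBody n, ∫ t, θ (radialFun K.carrier t) ∂(sphereMeasure n) =
        ∫ t, θ'.comp K.radial t ∂(sphereMeasure n) := fun K => by
      refine integral_congr_ae (Filter.Eventually.of_forall fun t => ?_)
      change θ (K.radial t) = θ (max (K.radial t) 0)
      rw [max_eq_left (K.radial_nonneg t)]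
    simp only [heq]
    have hint : ∀ f : C(USphere n, ℝ), Integrable (θ'.comp f) (sphereMeasure n) :=
      fun f => ContinuousMap.integrable_of_compactSpace _ _
    refine ⟨fun K L => ?_, ?_, fun φ hφ K => ?_⟩
    · rw [← integral_add (hint _) (hint _), ← integral_add (hint _) (hint _),
        StarBody.radial_union, StarBody.radial_inter]
      refine integral_congr_ae (Filter.Eventually.of_forall fun t => ?_)
      simp only [ContinuousMap.comp_apply, ContinuousMap.sup_apply, ContinuousMap.inf_apply]
      rcases le_total (K.radial t) (L.radial t) with h | h
      · rw [sup_eq_right.2 h, inf_eq_left.2 h, add_comm]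
      · rw [sup_eq_left.2 h, inf_eq_right.2 h]
    · exact StarBody.isRadialContinuous_comp_radial
        (F := fun f => ∫ t, θ'.comp f t ∂(sphereMeasure n))
        ((ContinuousMap.continuous_integral _).comp (ContinuousMap.continuous_postcomp θ'))
    · simp only [ContinuousMap.comp_apply, StarBody.radial_map_apply]
      exact integral_sphereMeasure_comp_isometry φ.symm (fun t => θ' (K.radial t))
        (θ'.continuous.comp K.radial.continuous)
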